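/- For integers $p\ge 1$, $q,r\ge 0$ let $s=p+q+r$ and let $E_{p,q,r}$ be the tree with vertices $1,\dots,s+1$ formed by three branches of lengths $p,q,r$ issuing from the root $1$, i.e. the union of the paths $1,2,\dots,p+1$; $\;1,p+2,\dots,p+q+1$; and $1,p+q+2,\dots,p+q+r+1$ (a branch of length $0$ consists of the root only). For a connected undirected graph $G$, possibly with loops, with adjacency matrix $A$, let $D=\operatorname{diag}(A\mathbf 1)$, $P=D^{-1}A$, and let $\kappa(G)=\operatorname{trace}\big((I-P+\mathbf 1 v^{\top})^{-1}\big)-1$ be Kemeny's constant of $G$, where $v$ is any vector with $v^{\top}\mathbf 1=1$ (the value does not depend on $v$). For a cut-edge $e$ of $G$, remove $e$, add a loop of the same weight as $e$ at each endpoint of $e$, and let $\hat G_1,\hat G_2$ be the two connected components obtained. The centrality of $e$ is $c(e)=\kappa(G)-\kappa(\hat G_1)-\kappa(\hat G_2)$. Theorem. For $1\le i\le p$, the edge $(i,i+1)$ is a cut-edge of $E_{p,q,r}$. The component containing $i+1$ has $\alpha_i=p+1-i$ vertices, the component containing $i$ has $\beta_i=q+r+i$ vertices, and the centrality $c(i)$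 of the edge $(i,i+1)$ is \[ c(i)=\frac23\,\alpha_i\beta_i+2qr\,\frac{2i-1}{2i-1+2q+2r}-\gamma,\qquad \gamma=\frac s3-\frac16+\frac{2pqr}{s}, \] where $\gamma$ does not depend on $i$. -/

import Mathlib

/-!
A finite weighted undirected graph, possibly with loops, is given by its adjacency matrix
`A : Matrix V V ℝ`, which is symmetric with nonnegative entries.
-/

open scoped Matrix

noncomputable section

/-- Kemeny's constant of an irreducible stochastic matrix `P`:
`trace ((I - P + 𝟏 vᵀ)⁻¹) - 1`, where `v` is any vector with `vᵀ 𝟏 = 1`. Here `v` is the uniform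
vector; `kemeny_eq_of_sum_eq_one` shows that the choice of `v` does not matter. -/
def kemeny {V : Type*} [Fintype V] [DecidableEq V] (P : Matrix V V ℝ) : ℝ :=
  ((1 - P + Matrix.vecMulVec 1 (fun _ => (Fintype.card V : ℝ)⁻¹))⁻¹).trace - 1

/-- The value of `kemeny P` does not depend on the vector `v` (when the matrix to be inverted is
nonsingular for `v`, it is so for the uniform vector too). -/
theorem kemeny_eq_of_sum_eq_one {V : Type*} [Fintype V] [DecidableEq V] (P : Matrix V V ℝ)
    (hP : P *ᵥ 1 = 1) (v : V → ℝ) (hv : v ⬝ᵥ 1 = 1)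
    (hdet : IsUnit (1 - P + Matrix.vecMulVec 1 v).det) :
    IsUnit (1 - P + Matrix.vecMulVec 1 (fun _ : V => (Fintype.card V : ℝ)⁻¹)).det ∧
      kemeny P = ((1 - P + Matrix.vecMulVec 1 v)⁻¹).trace - 1 := by
  have hne : Nonempty V := by
    by_contra h
    rw [not_nonempty_iff] at h
    simp [dotProduct] at hv
  set u : V → ℝ := fun _ => (Fintype.card V : ℝ)⁻¹ with hu
  have hu1 : u ⬝ᵥ 1 = 1 := by
    simp [hu, dotProduct]
  set M := 1 - P + Matrix.vecMulVec 1 v with hM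
  have hM1 : M *ᵥ 1 = 1 := by
    rw [hM, Matrix.add_mulVec, Matrix.sub_mulVec, hP, Matrix.one_mulVec,
      Matrix.vecMulVec_mulVec, hv]
    simp
  have hMi : M⁻¹ *ᵥ 1 = 1 := by
    calc M⁻¹ *ᵥ 1 = M⁻¹ *ᵥ (M *ᵥ 1) := by rw [hM1]
      _ = 1 := by rw [Matrix.mulVec_mulVec, Matrix.nonsing_inv_mul _ hdet, Matrix.one_mulVec]
  have huv : (u - v) ⬝ᵥ 1 = 0 := by rw [sub_dotProduct, hu1, hv, sub_self]
  have key : (1 - P + Matrix.vecMulVec 1 u) * (M⁻¹ - Matrix.vecMulVec 1 ((u - v) ᵥ* M⁻¹)) = 1 := by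
    have e1 : 1 - P + Matrix.vecMulVec 1 u = M + Matrix.vecMulVec 1 (u - v) := by
      ext a b
      simp [hM]
    rw [e1, add_mul, mul_sub, mul_sub, Matrix.mul_nonsing_inv _ hdet, Matrix.mul_vecMulVec, hM1,
      Matrix.vecMulVec_mul, Matrix.vecMulVec_mul_vecMulVec, huv]
    simp
  refine ⟨?_, ?_⟩
  · exact (Matrix.isUnit_iff_isUnit_det _).1 (IsUnit.of_mul_eq_one _ key)
  · unfold kemeny
    rw [Matrix.inv_eq_right_inv key, Matrix.trace_sub, Matrix.trace_vecMulVec, dotProduct_comm,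
      ← Matrix.dotProduct_mulVec, hMi, huv, sub_zero]

/-- The stochastic matrix `P = D⁻¹ A` of the random walk on a graph with adjacency matrix `A`,
where `D = diag (A 𝟏)`. -/
def walkMatrix {V : Type*} [Fintype V] (A : Matrix V V ℝ) : Matrix V V ℝ :=
  Matrix.of fun i j => A i j / (A *ᵥ 1) i

/-- Kemeny's constant of the connected graph with adjacency matrix `A`. -/
def graphKemeny {V : Type*} [Fintype V] [DecidableEq V] (A : Matrix V V ℝ) : ℝ :=
  kemeny (walkMatrix A)

/-- The simple graph underlying the weighted graph with (symmetric) adjacency matrix `A`: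
distinct vertices joined by an edge of nonzero weight. -/
def supportGraph {V : Type*} (A : Matrix V V ℝ) : SimpleGraph V :=
  SimpleGraph.fromRel fun i j => A i j ≠ 0

/-- Adjacency matrix of the graph obtained by removing the edge `(i, j)` and adding a loop, with the
weight of that edge, at each of `i` and `j`: `A + a i j • (e i - e j) (e i - e j)ᵀ`. -/
def cutAdj {V : Type*} [DecidableEq V] (A : Matrix V V ℝ) (i j : V) : Matrix V V ℝ :=
  A + A i j • Matrix.vecMulVec (Pi.single i 1 - Pi.single j 1) (Pi.single i 1 - Pi.single j 1)

/-- The set of vertices of the connected component of `k` in the graph with adjacency matrix `A`. -/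
def componentOf {V : Type*} (A : Matrix V V ℝ) (k : V) : Set V :=
  {v | (supportGraph A).Reachable k v}

/-- Adjacency matrix of the connected component of `k` in the graph with adjacency matrix `A`. -/
def componentAdj {V : Type*} (A : Matrix V V ℝ) (k : V) :
    Matrix (componentOf A k) (componentOf A k) ℝ :=
  A.submatrix Subtype.val Subtype.val

open Classical in
/-- The Kemeny-based centrality of the edge `(i, j)` of the connected graph `G` with adjacency
matrix `A`. With `Ĝ` the graph of `cutAdj A i j`, it is `κ(G) - κ(Ĝ₁) - κ(Ĝ₂)` if `(i, j)` is a
cut-edge, `Ĝ₁` and `Ĝ₂` being the components of `Ĝ` that contain `i` and `j`, and it is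
`κ(Ĝ) - κ(G)` otherwise. -/
def edgeCentrality {V : Type*} [Fintype V] (A : Matrix V V ℝ) (i j : V) : ℝ :=
  if (supportGraph A).IsBridge s(i, j) then
    graphKemeny A - graphKemeny (componentAdj (cutAdj A i j) i)
      - graphKemeny (componentAdj (cutAdj A i j) j)
  else
    graphKemeny (cutAdj A i j) - graphKemeny A

/-- The vertices `1, …, p + q + r + 1` of the three-branch tree. -/
abbrev BranchVertex (p q r : ℕ) : Type := {k : ℕ // k ∈ Finset.Icc 1 (p + q + r + 1)}

/-- The tree `E_{p,q,r}` with root `1` and three branches of lengths `p`, `q`, `r`: the paths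
`1, 2, …, p + 1`, then `1, p + 2, …, p + q + 1`, and `1, p + q + 2, …, p + q + r + 1`. -/
def threeBranchTree (p q r : ℕ) : SimpleGraph (BranchVertex p q r) :=
  SimpleGraph.fromRel fun a b =>
    (b.1 = a.1 + 1 ∧ (a.1 ≤ p ∨ (p + 2 ≤ a.1 ∧ a.1 ≤ p + q) ∨ p + q + 2 ≤ a.1)) ∨
      (a.1 = 1 ∧ (b.1 = p + 2 ∨ b.1 = p + q + 2))

open Classical in
/-- The `0`-`1` adjacency matrix of `E_{p,q,r}`. -/
def threeBranchAdj (p q r : ℕ) : Matrix (BranchVertex p q r) (BranchVertex p q r) ℝ :=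
  (threeBranchTree p q r).adjMatrix ℝ

/-- Vertex number `k` of the tree `E_{p,q,r}`. -/
def branchVertex (p q r k : ℕ) (h1 : 1 ≤ k) (h2 : k ≤ p + q + r + 1) : BranchVertex p q r :=
  ⟨k, Finset.mem_Icc.2 ⟨h1, h2⟩⟩

end

/-! Everything follows from one edge formula. In a rooted tree with unit edges and loops, let `d` be
the degree vector (a loop counts once), `vol` its sum, and `a` the total degree of the vertices
below an edge. Then Kemeny's constant is the sum of `a - a ^ 2 / vol` over the edges.

To prove it, complete the signed incidence matrix to a square matrix `B` by adding the indicator of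
the root as a column. The Laplacian is `B Bᵀ` minus a rank-one term at the root, and loops do not
enter it. The inverse of `B` is the zero-one ancestor matrix `F`, so `FᵀF` inverts the Laplacian up
to rank one. The trace formula `kemeny_eq_of_laplacian_mul_eq` then needs only the vector `F d`,
whose entries are the volumes `a`; this gives `IsRootedTreeAdj.graphKemeny_eq`.

Along a branch of `n` edges the volumes are `c + 1, c + 3, …, c + 2n - 1`, where `c` is the weight
of a loop at the far end (`sum_Ico_sub_sq_div`). The whole tree consists of three branches with `c =
0` and volume `2s`. The outer component is one branch whose loop sits at its root, so `c = 0` and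
the loop counts only in the volume. The inner component has three branches, and the one ending at
`i` has `c = 1`; its volume `2i - 1 + 2q + 2r` is the denominator in the theorem. The claim is then
an identity of rational functions. -/

/-! ### Kemeny's constant from a generalized inverse of the Laplacian -/

/-- If `N` inverts the weighted Laplacian `diag d * (1 - P)` up to a rank-one term `ρ 𝟏ᵀ`, Kemeny's
constant of `P` can be read off from `N`. -/
theorem kemeny_eq_of_laplacian_mul_eq {V : Type*} [Fintype V] [DecidableEq V]
    (P N : Matrix V V ℝ) (d ρ : V → ℝ) (hd : ∀ x, d x ≠ 0) (hvol : ∑ x, d x ≠ 0)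
    (hP : P *ᵥ 1 = 1)
    (hN : Matrix.diagonal d * (1 - P) * N = 1 - Matrix.vecMulVec ρ 1) :
    kemeny P = ∑ x, N x x * d x - (d ⬝ᵥ N *ᵥ d) / ∑ x, d x := by
  set vol := ∑ x, d x with hvol_def
  -- With `v` proportional to `d`, the projection `Q` below annihilates on the right every rank-one
  -- matrix with row `d`; the error term of `(1 - P) * (N * D)` has this form.
  set v : V → ℝ := vol⁻¹ • d with hv_def
  have hd1 : d ⬝ᵥ 1 = vol := by simp [dotProduct, hvol_def]
  have hv1 : v ⬝ᵥ 1 = 1 := by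
    rw [hv_def, smul_dotProduct, hd1, smul_eq_mul, inv_mul_cancel₀ hvol]
  have hP0 : (1 - P) *ᵥ 1 = 0 := by rw [Matrix.sub_mulVec, hP, Matrix.one_mulVec, sub_self]
  set D := Matrix.diagonal d with hD
  set Q : Matrix V V ℝ := 1 - Matrix.vecMulVec 1 v with hQ
  have hDi : Matrix.diagonal d⁻¹ * D = 1 := by
    rw [hD, Matrix.diagonal_mul_diagonal, ← Matrix.diagonal_one]
    congr 1
    funext x
    simp [hd x]
  have hM : (1 - P) * (N * D) = 1 - Matrix.vecMulVec (Matrix.diagonal d⁻¹ *ᵥ ρ) d := by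
    calc (1 - P) * (N * D)
        = Matrix.diagonal d⁻¹ * (D * (1 - P) * N) * D := by
          simp only [← mul_assoc, hDi, one_mul]
      _ = 1 - Matrix.vecMulVec (Matrix.diagonal d⁻¹ *ᵥ ρ) d := by
          rw [hN, mul_sub, sub_mul, mul_one, hDi, Matrix.mul_vecMulVec, Matrix.vecMulVec_mul]
          congr 2
          funext x
          simp [hD, Matrix.vecMul_diagonal]
  have hPQ : (1 - P) * Q = 1 - P := by
    rw [hQ, mul_sub, mul_one, Matrix.mul_vecMulVec, hP0]
    simp
  have hvQ : Matrix.vecMulVec (1 : V → ℝ) v * Q = 0 := by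
    rw [hQ, mul_sub, mul_one, Matrix.vecMulVec_mul_vecMulVec, hv1, one_smul, sub_self]
  have hQQ : Q * Q = Q := by
    conv_lhs => rw [hQ, sub_mul, one_mul, ← hQ, hvQ, sub_zero]
  have hdQ (a : V → ℝ) : Matrix.vecMulVec a d * Q = 0 := by
    rw [hQ, mul_sub, mul_one, Matrix.vecMulVec_mul_vecMulVec, hd1, hv_def]
    ext x y
    simp [Matrix.vecMulVec_apply]
    field_simp
    simp
  -- The compression of `N * D` by `Q` inverts `1 - P` on the kernel of `v`, and the rank-one
  -- summand takes care of the constants.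
  have key : (1 - P + Matrix.vecMulVec 1 v) * (Q * (N * D) * Q + Matrix.vecMulVec 1 v) = 1 := by
    calc (1 - P + Matrix.vecMulVec 1 v) * (Q * (N * D) * Q + Matrix.vecMulVec 1 v)
        = ((1 - P) * Q) * (N * D) * Q + (Matrix.vecMulVec 1 v * Q) * (N * D) * Q
          + (1 - P) * Matrix.vecMulVec 1 v + Matrix.vecMulVec 1 v * Matrix.vecMulVec 1 v := by
          noncomm_ring
      _ = Q + Matrix.vecMulVec 1 v := by
          rw [hPQ, hvQ, hM, Matrix.mul_vecMulVec, hP0, Matrix.vecMulVec_mul_vecMulVec, hv1,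
            sub_mul, hdQ]
          simp
      _ = 1 := by rw [hQ, sub_add_cancel]
  have hunit := (Matrix.isUnit_iff_isUnit_det _).1 (IsUnit.of_mul_eq_one _ key)
  rw [(kemeny_eq_of_sum_eq_one P hP v hv1 hunit).2, Matrix.inv_eq_right_inv key,
    Matrix.trace_add, Matrix.trace_vecMulVec, dotProduct_comm, hv1, add_sub_cancel_right,
    mul_assoc, Matrix.trace_mul_comm, mul_assoc, hQQ, hQ, mul_sub, mul_one, Matrix.trace_sub,
    Matrix.mul_vecMulVec, Matrix.trace_vecMulVec]
  congr 1
  · simp [Matrix.trace, hD, Matrix.mul_diagonal]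
  · have : (N * D) *ᵥ 1 = N *ᵥ d := by
      rw [← Matrix.mulVec_mulVec]
      congr 1
      funext x
      simp [hD, Matrix.mulVec_diagonal]
    rw [this, hv_def, dotProduct_smul, dotProduct_comm, smul_eq_mul, div_eq_inv_mul]

/-! ### Rooted trees: Laplacian, edge formula and volumes -/

/-- `le` is the ancestor relation of the tree with root `ρ` and parent function `par`. -/
structure IsAncestorRel {V : Type*} (ρ : V) (par : V → V) (le : V → V → Prop) : Prop where
  root_le : ∀ x, le ρ x
  eq_root : ∀ e, le e ρ → e = ρ
  le_iff : ∀ e y, y ≠ ρ → (le e y ↔ e = y ∨ le e (par y))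
  not_le_par : ∀ y, y ≠ ρ → ¬ le y (par y)

theorem IsAncestorRel.par_ne {V : Type*} {ρ : V} {par : V → V} {le : V → V → Prop}
    (h : IsAncestorRel ρ par le) {y : V}
    (hy : y ≠ ρ) : par y ≠ y :=
  fun hh => h.not_le_par y hy (by rw [hh]; exact (h.le_iff y y hy).2 (Or.inl rfl))

/-- `A` is the adjacency matrix of the tree with root `ρ` and parent function `par`, with all edges
of weight `1` and loops of nonnegative weights. -/
structure IsRootedTreeAdj {V : Type*} [DecidableEq V] (ρ : V) (par : V → V)
    (A : Matrix V V ℝ) : Prop where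
  loop_nonneg : ∀ x, 0 ≤ A x x
  apply_of_ne : ∀ x y, x ≠ y →
    A x y = (if x ≠ ρ ∧ par x = y then 1 else 0) + (if y ≠ ρ ∧ par y = x then 1 else 0)

open Classical in
/-- The zero-one matrix of a relation. -/
noncomputable def relMatrix {V : Type*} (le : V → V → Prop) : Matrix V V ℝ :=
  Matrix.of fun e x => if le e x then 1 else 0

/-- The signed vertex-edge incidence matrix of a rooted tree: the column of `y ≠ ρ` belongs to the
edge from `y` to its parent, and the column of the root is the indicator of the root. -/
def incidence {V : Type*} [DecidableEq V] (ρ : V) (par : V → V) : Matrix V V ℝ :=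
  Matrix.of fun x y => if y = ρ then (if x = ρ then 1 else 0)
    else (if x = y then 1 else 0) - (if x = par y then 1 else 0)

section RootedTree

variable {V : Type*} [Fintype V] [DecidableEq V] {ρ : V} {par : V → V} {le : V → V → Prop}
  {A : Matrix V V ℝ}

/-- The ancestors of `y` are those of its parent together with `y` itself, so the ancestor columns
of `y` and of its parent differ by the unit vector at `y`. -/
theorem IsAncestorRel.relMatrix_mul_incidence (h : IsAncestorRel ρ par le) :
    relMatrix le * incidence ρ par = 1 := by
  ext e y
  simp only [Matrix.mul_apply, relMatrix, incidence, Matrix.of_apply, Matrix.one_apply]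
  by_cases hy : y = ρ
  · subst hy
    simp only [if_true, mul_ite, mul_one, mul_zero, Finset.sum_ite_eq', Finset.mem_univ]
    by_cases he : e = y
    · subst he
      simp [h.root_le]
    · simpa [he] using fun hh => he (h.eq_root e hh)
  · simp only [hy, if_false, mul_sub, Finset.sum_sub_distrib, mul_ite, mul_one, mul_zero,
      Finset.sum_ite_eq', Finset.mem_univ, if_true]
    by_cases he : e = y
    · subst he
      simp [(h.le_iff e e hy).2 (Or.inl rfl), h.not_le_par e hy]
    · have : le e y ↔ le e (par y) := by simp [h.le_iff e y hy, he]
      by_cases hl : le e (par y) <;> simp [this, he, hl]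

theorem vecMul_incidence_one (hρ : ∀ y, y ≠ ρ → par y ≠ y) :
    (1 : V → ℝ) ᵥ* incidence ρ par = Pi.single ρ 1 := by
  funext y
  simp only [Matrix.vecMul, dotProduct, incidence, Matrix.of_apply, Pi.one_apply, one_mul]
  by_cases hy : y = ρ
  · subst hy
    simp
  · simp [hy]

theorem IsRootedTreeAdj.sum_apply_pos (hA : IsRootedTreeAdj ρ par A) (hρ : 0 < ∑ y, A ρ y)
    (hpar : ∀ y, y ≠ ρ → par y ≠ y) (x : V) : 0 < ∑ y, A x y := by
  by_cases hx : x = ρ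
  · rwa [hx]
  have hnn : ∀ y ∈ Finset.univ, 0 ≤ A x y := by
    intro y _
    by_cases hxy : x = y
    · subst hxy
      exact hA.loop_nonneg x
    · rw [hA.apply_of_ne x y hxy]
      positivity
  refine lt_of_lt_of_le ?_ (Finset.single_le_sum hnn (Finset.mem_univ (par x)))
  rw [hA.apply_of_ne x (par x) (hpar x hx).symm]
  simp only [ne_eq, hx, not_false_eq_true, and_self, if_true]
  positivity

theorem walkMatrix_mulVec_one {V : Type*} [Fintype V] {A : Matrix V V ℝ}
    (hd : ∀ x, ∑ y, A x y ≠ 0) : walkMatrix A *ᵥ 1 = 1 := by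
  funext x
  have := hd x
  simp only [walkMatrix, Matrix.mulVec, dotProduct, Matrix.of_apply, Pi.one_apply, mul_one]
  rw [← Finset.sum_div, div_self this]

theorem diagonal_mul_one_sub_walkMatrix (hd : ∀ x, ∑ y, A x y ≠ 0) :
    Matrix.diagonal (fun x => ∑ y, A x y) * (1 - walkMatrix A)
      = Matrix.diagonal (fun x => ∑ y, A x y) - A := by
  ext x y
  have := hd x
  rw [mul_sub, mul_one, Matrix.sub_apply, Matrix.sub_apply, Matrix.diagonal_mul]
  simp only [walkMatrix, Matrix.mulVec, dotProduct, Matrix.of_apply, Pi.one_apply, mul_one]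
  rw [mul_div_cancel₀ _ this]

/-- The off-diagonal entries agree edge by edge, and both sides have zero row sums. A loop adds its
weight to the degree and to the diagonal of `A`, so it cancels. -/
theorem IsRootedTreeAdj.laplacian_eq (hA : IsRootedTreeAdj ρ par A)
    (hpar : ∀ y, y ≠ ρ → par y ≠ y) :
    Matrix.diagonal (fun x => ∑ y, A x y) - A =
      incidence ρ par * (incidence ρ par)ᵀ
        - Matrix.vecMulVec (Pi.single ρ 1) (Pi.single ρ 1) := by
  set B := incidence ρ par with hB
  set K : Matrix V V ℝ :=
    B * Bᵀ - Matrix.vecMulVec (Pi.single ρ 1) (Pi.single ρ 1) with hK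
  have hoff : ∀ x z, x ≠ z → K x z = - A x z := by
    intro x z hxz
    have hterm : ∀ e, B x e * B z e
        = - ((if e = x then (if x ≠ ρ ∧ par x = z then 1 else 0) else 0)
            + (if e = z then (if z ≠ ρ ∧ par z = x then 1 else 0) else 0)) := by
      intro e
      simp only [hB, incidence, Matrix.of_apply]
      by_cases he : e = ρ
      · subst he
        by_cases h1 : x = e
        · subst h1
          simp [hxz, hxz.symm]
        · by_cases h2 : z = e
          · subst h2
            simp [hxz, hxz.symm]
          · simp [h1, h2, Ne.symm h1, Ne.symm h2]
      · have := hpar e he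
        simp only [he, if_false]
        grind
    rw [hK, Matrix.sub_apply, Matrix.mul_apply]
    simp only [Matrix.transpose_apply, hterm]
    rw [Finset.sum_neg_distrib, Finset.sum_add_distrib, hA.apply_of_ne x z hxz]
    simp only [Finset.sum_ite_eq', Finset.mem_univ, if_true, Matrix.vecMulVec_apply]
    have : (Pi.single ρ (1 : ℝ) : V → ℝ) x * (Pi.single ρ (1 : ℝ) : V → ℝ) z = 0 := by
      simp only [Pi.single_apply]
      grind
    rw [this, sub_zero]
  have hrow : K *ᵥ 1 = 0 := by
    rw [hK, Matrix.sub_mulVec, ← Matrix.mulVec_mulVec, Matrix.mulVec_transpose,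
      vecMul_incidence_one hpar, Matrix.vecMulVec_mulVec]
    funext x
    simp [hB, incidence, dotProduct, Pi.single_apply]
  have hrow' (x : V) : K x x = ∑ z ∈ Finset.univ.erase x, A x z := by
    have h1 := congrFun hrow x
    simp only [Matrix.mulVec, dotProduct, Pi.one_apply, mul_one, Pi.zero_apply] at h1
    rw [← Finset.add_sum_erase _ _ (Finset.mem_univ x),
      Finset.sum_congr rfl (fun z hz => hoff x z (Finset.ne_of_mem_erase hz).symm),
      Finset.sum_neg_distrib] at h1
    linarith
  ext x z
  by_cases hxz : x = z
  · subst hxz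
    rw [hrow' x, Matrix.sub_apply, Matrix.diagonal_apply_eq,
      ← Finset.add_sum_erase _ _ (Finset.mem_univ x)]
    ring
  · rw [hoff x z hxz, Matrix.sub_apply, Matrix.diagonal_apply_ne _ hxz, zero_sub]

/-- Weighted handshake lemma: each edge is counted at both ends, each loop once. -/
theorem IsRootedTreeAdj.sum_mul_sum (hA : IsRootedTreeAdj ρ par A)
    (hpar : ∀ y, y ≠ ρ → par y ≠ y) (f : V → ℝ) :
    ∑ x, f x * ∑ y, A x y
      = ∑ x, f x * A x x + ∑ y ∈ Finset.univ.erase ρ, (f y + f (par y)) := by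
  have h1 : ∀ x, ∑ y, A x y = A x x + ∑ y, ((if x ≠ ρ ∧ par x = y then (1 : ℝ) else 0)
      + (if y ≠ ρ ∧ par y = x then 1 else 0)) := by
    intro x
    -- The formula for the entries of `A` is assumed off the diagonal only; as it vanishes on the
    -- diagonal, it can be summed over all `y`.
    have h0 : (if x ≠ ρ ∧ par x = x then (1 : ℝ) else 0)
      + (if x ≠ ρ ∧ par x = x then 1 else 0) = 0 := by
      have := hpar x
      grind
    rw [← Finset.add_sum_erase _ _ (Finset.mem_univ x),
      ← Finset.add_sum_erase _ (fun y => (if x ≠ ρ ∧ par x = y then (1 : ℝ) else 0)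
      + (if y ≠ ρ ∧ par y = x then 1 else 0)) (Finset.mem_univ x), h0, zero_add]
    congr 1
    exact Finset.sum_congr rfl fun z hz =>
      hA.apply_of_ne x z (Finset.ne_of_mem_erase hz).symm
  simp only [h1, mul_add, Finset.sum_add_distrib, Finset.mul_sum]
  congr 1
  congr 1
  · rw [Finset.sum_erase_eq_sub (Finset.mem_univ ρ)]
    simp only [ite_and, mul_ite, mul_one, mul_zero]
    rw [eq_sub_iff_add_eq, ← Finset.add_sum_erase _ _ (Finset.mem_univ ρ),
      ← Finset.add_sum_erase _ f (Finset.mem_univ ρ)]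
    simp only [ne_eq, not_true_eq_false, if_false, Finset.sum_const_zero, zero_add]
    rw [add_comm]
    congr 1
    refine Finset.sum_congr rfl fun x hx => ?_
    simp [Finset.ne_of_mem_erase hx]
  · rw [Finset.sum_comm, ← Finset.add_sum_erase _ _ (Finset.mem_univ ρ)]
    simp only [ne_eq, not_true_eq_false, false_and, if_false, mul_zero, Finset.sum_const_zero,
      zero_add]
    refine Finset.sum_congr rfl fun y hy => ?_
    simp [Finset.ne_of_mem_erase hy]

/-- Kemeny's constant of a tree with loops, as a sum over the edges: an edge with volume `a` below
it contributes `a - a ^ 2 / vol`. -/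
theorem IsRootedTreeAdj.graphKemeny_eq (hA : IsRootedTreeAdj ρ par A)
    (h : IsAncestorRel ρ par le) (hρ : 0 < ∑ y, A ρ y) :
    graphKemeny A = ∑ e ∈ Finset.univ.erase ρ,
      ((∑ x, relMatrix le e x * ∑ y, A x y)
        - (∑ x, relMatrix le e x * ∑ y, A x y) ^ 2 / ∑ x, ∑ y, A x y) := by
  have hpar : ∀ y, y ≠ ρ → par y ≠ y := fun y hy => h.par_ne hy
  have hpos := hA.sum_apply_pos hρ hpar
  have hd : ∀ x, ∑ y, A x y ≠ 0 := fun x => (hpos x).ne'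
  have hvol : ∑ x, ∑ y, A x y ≠ 0 :=
    (Finset.sum_pos (fun x _ => hpos x) ⟨ρ, Finset.mem_univ ρ⟩).ne'
  set F := relMatrix le with hF
  set d : V → ℝ := fun x => ∑ y, A x y with hd_def
  set B := incidence ρ par with hB
  have hFB : F * B = 1 := h.relMatrix_mul_incidence
  have hBF : B * F = 1 := mul_eq_one_comm.1 hFB
  have hFρ : F *ᵥ Pi.single ρ 1 = Pi.single ρ 1 := by
    funext e
    simp only [hF, relMatrix, Matrix.mulVec_single_one, Matrix.col_apply, Matrix.of_apply]
    by_cases he : e = ρ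
    · subst he
      simp [h.root_le]
    · simpa [he] using fun hh => he (h.eq_root e hh)
  have hρF : (Pi.single ρ 1 : V → ℝ) ᵥ* F = 1 := by
    funext e
    simp [hF, relMatrix, h.root_le]
  -- Since `F` inverts `B`, the product `Fᵀ * F` inverts `B * Bᵀ`; the root term of the Laplacian
  -- leaves the rank-one error.
  have hN : Matrix.diagonal d * (1 - walkMatrix A) * (Fᵀ * F)
      = 1 - Matrix.vecMulVec (Pi.single ρ 1) 1 := by
    rw [diagonal_mul_one_sub_walkMatrix hd, hA.laplacian_eq hpar, sub_mul]
    congr 1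
    · calc B * Bᵀ * (Fᵀ * F) = B * (F * B)ᵀ * F := by
            rw [Matrix.transpose_mul]
            simp only [mul_assoc]
        _ = 1 := by rw [hFB, Matrix.transpose_one, mul_one, hBF]
    · rw [Matrix.vecMulVec_mul, ← Matrix.vecMul_vecMul, Matrix.vecMul_transpose, hFρ, hρF]
  rw [graphKemeny, kemeny_eq_of_laplacian_mul_eq _ _ d _ hd hvol (walkMatrix_mulVec_one hd) hN]
  -- Zero-one entries are idempotent, which makes the trace term linear in the volumes.
  have hFF : ∀ e x, F e x * F e x = F e x := by
    intro e x
    simp [hF, relMatrix]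
  have h1 : ∑ x, (Fᵀ * F) x x * d x = ∑ e, (F *ᵥ d) e := by
    simp only [Matrix.mul_apply, Matrix.transpose_apply, hFF, Finset.sum_mul, Matrix.mulVec,
      dotProduct]
    exact Finset.sum_comm
  have h2 : d ⬝ᵥ (Fᵀ * F) *ᵥ d = ∑ e, (F *ᵥ d) e ^ 2 := by
    rw [← Matrix.mulVec_mulVec, Matrix.dotProduct_mulVec, Matrix.vecMul_transpose]
    simp [dotProduct, sq]
  have h3 : (F *ᵥ d) ρ = ∑ x, d x := by
    simp [Matrix.mulVec, dotProduct, hF, relMatrix, h.root_le]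
  rw [h1, h2, Finset.sum_div, ← Finset.sum_sub_distrib,
    ← Finset.add_sum_erase _ _ (Finset.mem_univ ρ), h3]
  -- The root has the whole volume below it, so its summand vanishes and only edges remain.
  have h4 : ∑ x, d x - (∑ x, d x) ^ 2 / ∑ x, d x = 0 := by
    rw [sq, mul_div_cancel_right₀ _ hvol, sub_self]
  rw [h4, zero_add]
  rfl

/-- The volume of a branch of a rooted tree. -/
theorem IsRootedTreeAdj.branch_volume (hA : IsRootedTreeAdj ρ par A)
    (h : IsAncestorRel ρ par le) {e : V} (he : e ≠ ρ) :
    ∑ x, relMatrix le e x * ∑ y, A x y = ∑ x, relMatrix le e x * (A x x + 2) - 1 := by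
  have hFρ : relMatrix le e ρ = 0 := by
    simpa [relMatrix] using fun hh => he (h.eq_root e hh)
  -- An edge from `y` to its parent has both ends below `e` or neither, except for `y = e`, where
  -- only one end is: this is the `-1` in the volume.
  have hF : ∀ y ∈ Finset.univ.erase ρ, relMatrix le e y + relMatrix le e (par y)
      = relMatrix le e y * 2 - if e = y then 1 else 0 := by
    intro y hy
    have hy' := Finset.ne_of_mem_erase hy
    simp only [relMatrix, Matrix.of_apply]
    by_cases hey : e = y
    · subst hey
      simp [(h.le_iff e e he).2 (Or.inl rfl), h.not_le_par e he]
      norm_num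
    · have : le e y ↔ le e (par y) := by simp [h.le_iff e y hy', hey]
      by_cases hl : le e (par y) <;> simp [this, hey, hl]
      norm_num
  rw [hA.sum_mul_sum (fun y hy => h.par_ne hy), Finset.sum_congr rfl hF, Finset.sum_sub_distrib,
    Finset.sum_erase _ (by rw [hFρ, zero_mul])]
  simp only [mul_add, Finset.sum_add_distrib, Finset.sum_ite_eq]
  simp [he]
  ring

/-- The volume of a rooted tree with loops. -/
theorem IsRootedTreeAdj.volume_eq (hA : IsRootedTreeAdj ρ par A)
    (hpar : ∀ y, y ≠ ρ → par y ≠ y) :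
    ∑ x, ∑ y, A x y = ∑ x, (A x x + 2) - 2 := by
  have := hA.sum_mul_sum hpar 1
  simp only [Pi.one_apply, one_mul] at this
  rw [this, Finset.sum_add_distrib (f := fun x => A x x),
    Finset.sum_erase_eq_sub (Finset.mem_univ ρ)]
  simp only [Finset.sum_const, nsmul_eq_mul]
  ring

end RootedTree

/-- Kemeny's constant of a rooted tree with loops whose vertices are numbered by the elements of a
finite set `S` of natural numbers. -/
theorem graphKemeny_eq_sum_nat {V : Type*} [Fintype V] [DecidableEq V] (A : Matrix V V ℝ)
    (ν : V → ℕ) (hν : Function.Injective ν) (S : Finset ℕ) (hS : ∀ k, k ∈ S ↔ ∃ x, ν x = k)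
    (ρ : ℕ) (hρ : ρ ∈ S) (par : ℕ → ℕ) (hpar : ∀ k ∈ S, k ≠ ρ → par k ∈ S)
    (le : ℕ → ℕ → Prop) [DecidableRel le]
    (root_le : ∀ k ∈ S, le ρ k) (eq_root : ∀ e ∈ S, le e ρ → e = ρ)
    (le_iff : ∀ e ∈ S, ∀ k ∈ S, k ≠ ρ → (le e k ↔ e = k ∨ le e (par k)))
    (not_le_par : ∀ k ∈ S, k ≠ ρ → ¬ le k (par k))
    (ℓ : ℕ → ℝ) (hℓ0 : ∀ k, 0 ≤ ℓ k) (hℓ : ∀ x, A x x = ℓ (ν x))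
    (hA : ∀ x y, x ≠ y → A x y = (if ν x ≠ ρ ∧ par (ν x) = ν y then 1 else 0)
      + (if ν y ≠ ρ ∧ par (ν y) = ν x then 1 else 0))
    (hdeg : 0 < ℓ ρ ∨ ∃ k ∈ S, k ≠ ρ ∧ par k = ρ) :
    graphKemeny A = ∑ e ∈ S.erase ρ, ((∑ k ∈ S with le e k, (ℓ k + 2) - 1)
      - (∑ k ∈ S with le e k, (ℓ k + 2) - 1) ^ 2 / (∑ k ∈ S, (ℓ k + 2) - 2)) := by
  have hνS : ∀ x, ν x ∈ S := fun x => (hS _).2 ⟨x, rfl⟩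
  obtain ⟨x₀, hx₀⟩ := (hS ρ).1 hρ
  have hne : ∀ x, x ≠ x₀ ↔ ν x ≠ ρ := fun x => by rw [← hx₀, hν.ne_iff]
  have hex : ∀ x, ∃ y, x ≠ x₀ → ν y = par (ν x) := by
    intro x
    by_cases hx : x = x₀
    · exact ⟨x, fun hh => absurd hx hh⟩
    · obtain ⟨y, hy⟩ := (hS _).1 (hpar _ (hνS x) ((hne x).1 hx))
      exact ⟨y, fun _ => hy⟩
  -- The value at the root is irrelevant, since the parent function is only used away from it.
  choose parV hparV using hex
  have hanc : IsAncestorRel x₀ parV (fun e x => le (ν e) (ν x)) := by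
    refine ⟨fun x => ?_, fun e he => ?_, fun e y hy => ?_, fun y hy => ?_⟩
    · simpa only [hx₀] using root_le _ (hνS x)
    · apply hν
      simp only [hx₀] at he ⊢
      exact eq_root _ (hνS e) he
    · rw [hparV y hy, le_iff _ (hνS e) _ (hνS y) ((hne y).1 hy), hν.eq_iff]
    · rw [hparV y hy]
      exact not_le_par _ (hνS y) ((hne y).1 hy)
  have htree : IsRootedTreeAdj x₀ parV A := by
    refine ⟨fun x => by rw [hℓ]; exact hℓ0 _, fun x y hxy => ?_⟩
    have hcond : ∀ x y, (x ≠ x₀ ∧ parV x = y) ↔ (ν x ≠ ρ ∧ par (ν x) = ν y) := by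
      intro x y
      rw [hne]
      refine and_congr_right fun hx => ?_
      rw [← hparV x ((hne x).2 hx), hν.eq_iff]
    rw [hA x y hxy]
    simp only [hcond]
  have hpos : 0 < ∑ y, A x₀ y := by
    have hnn : ∀ y ∈ Finset.univ, 0 ≤ A x₀ y := by
      intro y _
      by_cases hxy : x₀ = y
      · rw [← hxy, hℓ]
        exact hℓ0 _
      · rw [hA _ _ hxy]
        positivity
    rcases hdeg with h | ⟨k, hk, hkρ, hkp⟩
    · refine lt_of_lt_of_le ?_ (Finset.single_le_sum hnn (Finset.mem_univ x₀))
      rwa [hℓ, hx₀]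
    · obtain ⟨y, hy⟩ := (hS k).1 hk
      have hyx : x₀ ≠ y := by
        rintro rfl
        exact hkρ (hy ▸ hx₀)
      refine lt_of_lt_of_le ?_ (Finset.single_le_sum hnn (Finset.mem_univ y))
      rw [hA _ _ hyx, hx₀, hy, if_pos (⟨hkρ, hkp⟩ : k ≠ ρ ∧ par k = ρ)]
      positivity
  have hsum : ∀ g : ℕ → ℝ, ∑ x, g (ν x) = ∑ k ∈ S, g k := by
    intro g
    have : S = Finset.univ.map ⟨ν, hν⟩ := by
      ext k
      simp [hS]
    rw [this, Finset.sum_map]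
    rfl
  have hbr : ∀ e, ∑ x, relMatrix (fun e x => le (ν e) (ν x)) e x * (A x x + 2)
      = ∑ k ∈ S with le (ν e) k, (ℓ k + 2) := by
    intro e
    rw [Finset.sum_filter, ← hsum]
    refine Finset.sum_congr rfl fun x _ => ?_
    by_cases hl : le (ν e) (ν x) <;> simp [relMatrix, hl, hℓ]
  rw [htree.graphKemeny_eq hanc hpos, htree.volume_eq fun y hy => hanc.par_ne hy]
  have hvol : ∑ x, (A x x + 2) = ∑ k ∈ S, (ℓ k + 2) := by
    rw [← hsum]
    simp only [hℓ]
  have herase : ∀ g : ℕ → ℝ, ∑ x ∈ Finset.univ.erase x₀, g (ν x) = ∑ k ∈ S.erase ρ, g k := by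
    intro g
    rw [Finset.sum_erase_eq_sub (Finset.mem_univ x₀), Finset.sum_erase_eq_sub hρ, hsum, hx₀]
  rw [hvol, ← herase]
  refine Finset.sum_congr rfl fun e he => ?_
  rw [htree.branch_volume hanc (Finset.ne_of_mem_erase he), hbr]

/-! ### The numbering of the three-branch tree and the sums along its branches -/

/-- The neighbour of vertex `k ≥ 2` of `E_{p,q,r}` on the path to the root `1`. -/
def branchParent (p q k : ℕ) : ℕ := if k = p + 2 ∨ k = p + q + 2 then 1 else k - 1

/-- The last vertex, in the numbering, below vertex `k` of `E_{p,q,r}`. -/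
def branchEnd (p q r k : ℕ) : ℕ :=
  if k ≤ 1 then p + q + r + 1 else if k ≤ p + 1 then p + 1
    else if k ≤ p + q + 1 then p + q + 1 else p + q + r + 1

theorem branchParent_lt {p q k : ℕ} (hk : 2 ≤ k) : branchParent p q k < k := by
  unfold branchParent
  split_ifs <;> omega

theorem one_le_branchParent {p q k : ℕ} (hk : 2 ≤ k) : 1 ≤ branchParent p q k := by
  unfold branchParent
  split_ifs <;> omega

theorem le_branchEnd {p q r k : ℕ} (hk : k ≤ p + q + r + 1) : k ≤ branchEnd p q r k := by
  unfold branchEnd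
  split_ifs <;> omega

/-- Labels increase by one along each branch away from the root, so the descendants of a vertex form
an interval of labels. This is the recursion required of an ancestor relation. -/
theorem le_and_le_branchEnd_iff {p q r e k : ℕ} (he : 1 ≤ e) (he' : e ≤ p + q + r + 1)
    (hk : 2 ≤ k) (hk' : k ≤ p + q + r + 1) :
    (e ≤ k ∧ k ≤ branchEnd p q r e) ↔
      e = k ∨ (e ≤ branchParent p q k ∧ branchParent p q k ≤ branchEnd p q r e) := by
  unfold branchEnd branchParent
  split_ifs <;> omega

/-- Kemeny's constant of a part of `E_{p,q,r}` with a loop of weight `ε` at vertex `m`. -/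
theorem graphKemeny_eq_sum_branch {V : Type*} [Fintype V] [DecidableEq V] (A : Matrix V V ℝ)
    (p q r : ℕ) (ν : V → ℕ) (hν : Function.Injective ν) (S : Finset ℕ)
    (hS : ∀ k, k ∈ S ↔ ∃ x, ν x = k) (ρ : ℕ) (hρ : ρ ∈ S)
    (hSle : ∀ k ∈ S, 1 ≤ ρ ∧ ρ ≤ k ∧ k ≤ branchEnd p q r ρ ∧ k ≤ p + q + r + 1)
    (hpar : ∀ k ∈ S, k ≠ ρ → branchParent p q k ∈ S) (m : ℕ) (ε : ℝ) (hε : 0 ≤ ε)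
    (hdiag : ∀ x, A x x = if ν x = m then ε else 0)
    (hA : ∀ x y, x ≠ y → A x y = (if ν x ≠ ρ ∧ branchParent p q (ν x) = ν y then 1 else 0)
      + (if ν y ≠ ρ ∧ branchParent p q (ν y) = ν x then 1 else 0))
    (hdeg : (ρ = m ∧ 0 < ε) ∨ ∃ k ∈ S, k ≠ ρ ∧ branchParent p q k = ρ) (f : ℕ → ℝ) (v : ℝ)
    (hf : ∀ e ∈ S.erase ρ, f e = 2 * ((S.filter fun k => e ≤ k ∧ k ≤ branchEnd p q r e).card : ℝ)
      - 1 + if m ∈ S ∧ e ≤ m ∧ m ≤ branchEnd p q r e then ε else 0)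
    (hv : v = 2 * ((S.card : ℝ) - 1) + if m ∈ S then ε else 0) :
    graphKemeny A = ∑ e ∈ S.erase ρ, (f e - f e ^ 2 / v) := by
  rw [graphKemeny_eq_sum_nat A ν hν S hS ρ hρ (branchParent p q) hpar
    (fun e k => e ≤ k ∧ k ≤ branchEnd p q r e) (fun k hk => ⟨(hSle k hk).2.1, (hSle k hk).2.2.1⟩)
    (fun e he h => le_antisymm h.1 (hSle e he).2.1)
    (fun e he k hk hkρ => le_and_le_branchEnd_iff ((hSle e he).1.trans (hSle e he).2.1)
      (hSle e he).2.2.2 (by have := hSle k hk; omega) (hSle k hk).2.2.2)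
    (fun k hk hkρ h => absurd h.1 (not_le.2 (branchParent_lt (by have := hSle k hk; omega))))
    (fun k => if k = m then ε else 0) (fun k => by split_ifs <;> simp [hε]) hdiag hA
    (hdeg.imp_left fun h => by rw [if_pos h.1]; exact h.2)]
  have hv' : ∑ k ∈ S, ((if k = m then ε else 0) + 2) - 2 = v := by
    rw [hv, Finset.sum_add_distrib, Finset.sum_ite_eq', Finset.sum_const, nsmul_eq_mul]
    ring
  refine Finset.sum_congr rfl fun e he => ?_
  rw [hv']
  have hf' : ∑ k ∈ S with e ≤ k ∧ k ≤ branchEnd p q r e, ((if k = m then ε else 0) + 2) - 1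
      = f e := by
    rw [hf e he, Finset.sum_add_distrib, Finset.sum_ite_eq', Finset.sum_const, nsmul_eq_mul]
    simp only [Finset.mem_filter]
    ring
  rw [hf']

theorem sum_range_sub_sq_div (n : ℕ) (c v : ℝ) :
    ∑ k ∈ Finset.range n, ((c - 2 * k) - (c - 2 * k) ^ 2 / v)
      = n * c - n * (n - 1)
        - (n * c ^ 2 - 2 * c * n * (n - 1) + 2 / 3 * n * (n - 1) * (2 * n - 1)) / v := by
  induction n with
  | zero => simp
  | succ n ih =>
    rw [Finset.sum_range_succ, ih]
    push_cast
    ring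

/-- Contribution to Kemeny's constant of a branch on the vertices `a + 1, …, a + n`. -/
theorem sum_Ico_sub_sq_div (f : ℕ → ℝ) (a n : ℕ) (c v : ℝ)
    (hf : ∀ k < n, f (a + 1 + k) = 2 * n - 1 + c - 2 * k) :
    ∑ e ∈ Finset.Ico (a + 1) (a + n + 1), (f e - f e ^ 2 / v)
      = n * (n + c) - (n * (2 * n - 1) * (2 * n + 1) / 3 + 2 * c * n ^ 2 + n * c ^ 2) / v := by
  rw [Finset.sum_Ico_eq_sum_range, show a + n + 1 - (a + 1) = n by omega,
    Finset.sum_congr rfl fun k hk => by rw [hf k (Finset.mem_range.1 hk)],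
    sum_range_sub_sq_div n (2 * n - 1 + c) v]
  ring

/-! ### Adjacency in the tree and after cutting an edge -/

theorem threeBranchTree_adj_iff {p q r : ℕ} (x y : BranchVertex p q r) :
    (threeBranchTree p q r).Adj x y ↔
      (x.1 ≠ 1 ∧ branchParent p q x.1 = y.1) ∨ (y.1 ≠ 1 ∧ branchParent p q y.1 = x.1) := by
  obtain ⟨x, hx⟩ := x
  obtain ⟨y, hy⟩ := y
  rw [Finset.mem_Icc] at hx hy
  simp only [threeBranchTree, SimpleGraph.fromRel_adj, ne_eq, Subtype.mk.injEq, branchParent]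
  split_ifs <;> omega

theorem threeBranchAdj_apply_self {p q r : ℕ} (x : BranchVertex p q r) :
    threeBranchAdj p q r x x = 0 := by
  simp [threeBranchAdj]

theorem threeBranchAdj_apply {p q r : ℕ} (x y : BranchVertex p q r) :
    threeBranchAdj p q r x y = (if x.1 ≠ 1 ∧ branchParent p q x.1 = y.1 then 1 else 0)
      + (if y.1 ≠ 1 ∧ branchParent p q y.1 = x.1 then 1 else 0) := by
  have hx := Finset.mem_Icc.1 x.2
  have hy := Finset.mem_Icc.1 y.2
  -- Parents have smaller labels, so two vertices cannot be each other's parent and the two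
  -- indicators never add up to `2`.
  have h : ¬ ((x.1 ≠ 1 ∧ branchParent p q x.1 = y.1) ∧
      (y.1 ≠ 1 ∧ branchParent p q y.1 = x.1)) := by
    rintro ⟨⟨h1, h2⟩, h3, h4⟩
    have := branchParent_lt (p := p) (q := q) (k := x.1) (by omega)
    have := branchParent_lt (p := p) (q := q) (k := y.1) (by omega)
    omega
  simp only [threeBranchAdj, SimpleGraph.adjMatrix_apply, threeBranchTree_adj_iff]
  by_cases h1 : x.1 ≠ 1 ∧ branchParent p q x.1 = y.1
  · have h2 : ¬ (y.1 ≠ 1 ∧ branchParent p q y.1 = x.1) := fun h2 => h ⟨h1, h2⟩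
    rw [if_pos (Or.inl h1), if_pos h1, if_neg h2, add_zero]
  · by_cases h2 : y.1 ≠ 1 ∧ branchParent p q y.1 = x.1
    · rw [if_pos (Or.inr h2), if_pos h2, if_neg h1, zero_add]
    · rw [if_neg (not_or.2 ⟨h1, h2⟩), if_neg h1, if_neg h2, add_zero]

theorem supportGraph_threeBranchAdj (p q r : ℕ) :
    supportGraph (threeBranchAdj p q r) = threeBranchTree p q r := by
  ext x y
  simp only [supportGraph, SimpleGraph.fromRel_adj, threeBranchAdj, SimpleGraph.adjMatrix_apply,
    ne_eq, ite_eq_right_iff, one_ne_zero, imp_false, not_not, (threeBranchTree p q r).adj_comm y x,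
    or_self, and_iff_right_iff_imp]
  exact fun h => h.ne

theorem cutAdj_apply {V : Type*} [DecidableEq V] (A : Matrix V V ℝ) (i j x y : V) :
    cutAdj A i j x y = A x y + A i j * (((if x = i then 1 else 0) - (if x = j then 1 else 0))
      * ((if y = i then 1 else 0) - (if y = j then 1 else 0))) := by
  simp [cutAdj, Matrix.vecMulVec_apply, Pi.single_apply]

theorem cutAdj_apply_of_ne {V : Type*} [DecidableEq V] {A : Matrix V V ℝ} {i j x y : V}
    (hxy : x ≠ y) (h : ¬ (x = i ∧ y = j) ∧ ¬ (x = j ∧ y = i)) : cutAdj A i j x y = A x y := by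
  rw [cutAdj_apply]
  grind

theorem cutAdj_apply_edge {V : Type*} [DecidableEq V] {A : Matrix V V ℝ} {i j : V}
    (hij : i ≠ j) : cutAdj A i j i j = 0 := by
  rw [cutAdj_apply]
  simp [hij, hij.symm]

theorem cutAdj_apply_edge' {V : Type*} [DecidableEq V] {A : Matrix V V ℝ} (hA : A.IsSymm)
    {i j : V} (hij : i ≠ j) : cutAdj A i j j i = 0 := by
  rw [cutAdj_apply, hA.apply]
  simp [hij, hij.symm]

/-- Cutting an edge deletes it from the underlying simple graph. -/
theorem supportGraph_cutAdj {V : Type*} [DecidableEq V] {A : Matrix V V ℝ} (hA : A.IsSymm)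
    {i j : V} (hij : i ≠ j) :
    supportGraph (cutAdj A i j) = (supportGraph A).deleteEdges {s(i, j)} := by
  ext x y
  simp only [supportGraph, SimpleGraph.fromRel_adj, SimpleGraph.deleteEdges_adj,
    Set.mem_singleton_iff, Sym2.eq_iff]
  by_cases hxy : x = y
  · simp [hxy]
  by_cases h1 : x = i ∧ y = j
  · obtain ⟨rfl, rfl⟩ := h1
    simp [cutAdj_apply_edge hij, cutAdj_apply_edge' hA hij]
  by_cases h2 : x = j ∧ y = i
  · obtain ⟨rfl, rfl⟩ := h2
    simp [cutAdj_apply_edge hij, cutAdj_apply_edge' hA hij]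
  rw [cutAdj_apply_of_ne hxy ⟨h1, h2⟩,
    cutAdj_apply_of_ne (Ne.symm hxy) ⟨fun h => h2 h.symm, fun h => h1 h.symm⟩]
  tauto

theorem reachable_mem_iff {V : Type*} {G : SimpleGraph V} {C : V → Prop}
    (h : ∀ x y, G.Adj x y → (C x ↔ C y)) {x y : V} (hxy : G.Reachable x y) : C x ↔ C y := by
  obtain ⟨w⟩ := hxy
  induction w with
  | nil => rfl
  | cons hadj _ ih => exact (h _ _ hadj).trans ih

/-! ### The two components left by the cut -/

section Cut

variable {p q r i : ℕ}

/-- The edge from `i` to `i + 1` is the only one between the segment `i + 1, …, p + 1` and its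
complement. Membership in the segment is therefore invariant along walks in the cut graph. -/
theorem threeBranchTree_cut_adj_iff {u w : BranchVertex p q r} (hu : u.1 = i) (hw : w.1 = i + 1)
    (hi1 : 1 ≤ i) (hip : i ≤ p) (x y : BranchVertex p q r) :
    ((threeBranchTree p q r).deleteEdges {s(u, w)}).Adj x y ↔ (threeBranchTree p q r).Adj x y ∧
      ((i + 1 ≤ x.1 ∧ x.1 ≤ p + 1) ↔ (i + 1 ≤ y.1 ∧ y.1 ≤ p + 1)) := by
  rw [SimpleGraph.deleteEdges_adj]
  refine and_congr_right fun hxy => ?_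
  rw [threeBranchTree_adj_iff] at hxy
  have hx := Finset.mem_Icc.1 x.2
  have hy := Finset.mem_Icc.1 y.2
  simp only [Set.mem_singleton_iff, Sym2.eq_iff, Subtype.ext_iff, hu, hw]
  unfold branchParent at hxy
  split_ifs at hxy <;> omega

theorem cut_adj_parent {u w : BranchVertex p q r} (hu : u.1 = i) (hw : w.1 = i + 1)
    (hi1 : 1 ≤ i) (hip : i ≤ p) {x y : BranchVertex p q r} (hx1 : x.1 ≠ 1) (hxi : x.1 ≠ i + 1)
    (hy : y.1 = branchParent p q x.1) :
    ((threeBranchTree p q r).deleteEdges {s(u, w)}).Adj x y := by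
  rw [threeBranchTree_cut_adj_iff hu hw hi1 hip, threeBranchTree_adj_iff, hy]
  refine ⟨Or.inl ⟨hx1, rfl⟩, ?_⟩
  have hx := Finset.mem_Icc.1 x.2
  unfold branchParent
  split_ifs <;> omega

theorem exists_parent {x : BranchVertex p q r} (hx1 : x.1 ≠ 1) :
    ∃ y : BranchVertex p q r, y.1 = branchParent p q x.1 := by
  have hx := Finset.mem_Icc.1 x.2
  have h1 := one_le_branchParent (p := p) (q := q) (k := x.1) (by omega)
  have h2 := branchParent_lt (p := p) (q := q) (k := x.1) (by omega)
  exact ⟨⟨branchParent p q x.1, Finset.mem_Icc.2 ⟨h1, by omega⟩⟩, rfl⟩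

/-- Climb from parent to parent: labels decrease, and the walk stays in the segment until it meets
`i + 1`. -/
theorem reachable_outer {u w : BranchVertex p q r} (hu : u.1 = i) (hw : w.1 = i + 1)
    (hi1 : 1 ≤ i) (hip : i ≤ p) (n : ℕ) : ∀ x : BranchVertex p q r, x.1 = n →
      i + 1 ≤ x.1 → x.1 ≤ p + 1 →
      ((threeBranchTree p q r).deleteEdges {s(u, w)}).Reachable x w := by
  induction n using Nat.strong_induction_on with
  | _ n ih =>
    intro x hxn h1 h2
    by_cases hxi : x.1 = i + 1
    · rw [show x = w from Subtype.ext (by omega)]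
    · obtain ⟨y, hy⟩ := exists_parent (x := x) (by omega)
      have hadj := cut_adj_parent hu hw hi1 hip (by omega) hxi hy
      have hlt := branchParent_lt (p := p) (q := q) (k := x.1) (by omega)
      have hC := ((threeBranchTree_cut_adj_iff hu hw hi1 hip x y).1 hadj).2
      exact hadj.reachable.trans (ih y.1 (by omega) y rfl (by omega) (by omega))

/-- Outside the segment the climb never uses the deleted edge, so it reaches the root. -/
theorem reachable_root {u w z : BranchVertex p q r} (hu : u.1 = i) (hw : w.1 = i + 1)
    (hz : z.1 = 1) (hi1 : 1 ≤ i) (hip : i ≤ p) (n : ℕ) : ∀ x : BranchVertex p q r, x.1 = n →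
      ¬ (i + 1 ≤ x.1 ∧ x.1 ≤ p + 1) →
      ((threeBranchTree p q r).deleteEdges {s(u, w)}).Reachable x z := by
  induction n using Nat.strong_induction_on with
  | _ n ih =>
    intro x hxn h1
    have hx := Finset.mem_Icc.1 x.2
    by_cases hx1 : x.1 = 1
    · rw [show x = z from Subtype.ext (by omega)]
    · obtain ⟨y, hy⟩ := exists_parent hx1
      have hadj := cut_adj_parent hu hw hi1 hip hx1 (by omega) hy
      have hlt := branchParent_lt (p := p) (q := q) (k := x.1) (by omega)
      have hC := ((threeBranchTree_cut_adj_iff hu hw hi1 hip x y).1 hadj).2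
      exact hadj.reachable.trans (ih y.1 (by omega) y rfl (by omega))

theorem threeBranchAdj_isSymm (p q r : ℕ) : (threeBranchAdj p q r).IsSymm := by
  refine Matrix.IsSymm.ext fun x y => ?_
  rw [threeBranchAdj_apply, threeBranchAdj_apply, add_comm]

theorem supportGraph_cut_eq {u w : BranchVertex p q r} (huw : u ≠ w) :
    supportGraph (cutAdj (threeBranchAdj p q r) u w)
      = (threeBranchTree p q r).deleteEdges {s(u, w)} := by
  rw [supportGraph_cutAdj (threeBranchAdj_isSymm p q r) huw, supportGraph_threeBranchAdj]

theorem mem_componentOf_outer {u w : BranchVertex p q r} (hu : u.1 = i) (hw : w.1 = i + 1)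
    (hi1 : 1 ≤ i) (hip : i ≤ p) (x : BranchVertex p q r) :
    x ∈ componentOf (cutAdj (threeBranchAdj p q r) u w) w ↔ i + 1 ≤ x.1 ∧ x.1 ≤ p + 1 := by
  have huw : u ≠ w := fun h => by rw [h] at hu; omega
  simp only [componentOf, Set.mem_ofPred_eq, supportGraph_cut_eq huw]
  refine ⟨fun h => ?_, fun h => (reachable_outer hu hw hi1 hip _ x rfl h.1 h.2).symm⟩
  exact (reachable_mem_iff (fun x y hxy =>
    ((threeBranchTree_cut_adj_iff hu hw hi1 hip x y).1 hxy).2) h).1 (by omega)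

theorem mem_componentOf_inner {u w : BranchVertex p q r} (hu : u.1 = i) (hw : w.1 = i + 1)
    (hi1 : 1 ≤ i) (hip : i ≤ p) (x : BranchVertex p q r) :
    x ∈ componentOf (cutAdj (threeBranchAdj p q r) u w) u ↔ ¬ (i + 1 ≤ x.1 ∧ x.1 ≤ p + 1) := by
  have huw : u ≠ w := fun h => by rw [h] at hu; omega
  simp only [componentOf, Set.mem_ofPred_eq, supportGraph_cut_eq huw]
  constructor
  · intro h
    rw [← reachable_mem_iff (C := fun x : BranchVertex p q r => i + 1 ≤ x.1 ∧ x.1 ≤ p + 1)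
      (fun x y hxy => ((threeBranchTree_cut_adj_iff hu hw hi1 hip x y).1 hxy).2) h]
    omega
  · intro h
    have hz : (branchVertex p q r 1 le_rfl (by omega)).1 = 1 := rfl
    exact (reachable_root hu hw hz hi1 hip _ u rfl (by omega)).trans
      (reachable_root hu hw hz hi1 hip _ x rfl h).symm

theorem threeBranchTree_isBridge {u w : BranchVertex p q r} (hu : u.1 = i) (hw : w.1 = i + 1)
    (hi1 : 1 ≤ i) (hip : i ≤ p) : (threeBranchTree p q r).IsBridge s(u, w) := by
  rw [SimpleGraph.isBridge_iff]
  intro h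
  have := reachable_mem_iff (C := fun x : BranchVertex p q r => i + 1 ≤ x.1 ∧ x.1 ≤ p + 1)
      (fun x y hxy => ((threeBranchTree_cut_adj_iff hu hw hi1 hip x y).1 hxy).2) h
  omega

theorem threeBranchTree_adj_edge {u w : BranchVertex p q r} (hu : u.1 = i) (hw : w.1 = i + 1)
    (hi1 : 1 ≤ i) (hip : i ≤ p) : (threeBranchTree p q r).Adj u w := by
  rw [threeBranchTree_adj_iff, hu, hw]
  unfold branchParent
  split_ifs <;> omega

theorem cutAdj_threeBranchAdj_apply_self {u w : BranchVertex p q r} (hu : u.1 = i)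
    (hw : w.1 = i + 1) (hi1 : 1 ≤ i) (hip : i ≤ p) (x : BranchVertex p q r) :
    cutAdj (threeBranchAdj p q r) u w x x = if x.1 = i ∨ x.1 = i + 1 then 1 else 0 := by
  have h1 : threeBranchAdj p q r u w = 1 := by
    simp [threeBranchAdj, threeBranchTree_adj_edge hu hw hi1 hip]
  rw [cutAdj_apply, threeBranchAdj_apply_self, h1]
  simp only [Subtype.ext_iff, hu, hw]
  by_cases h : x.1 = i
  · simp [h]
  · by_cases h' : x.1 = i + 1 <;> simp [h, h']

theorem ncard_componentOf {V : Type*} {C : Set V} {ν : V → ℕ} (hν : Function.Injective ν)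
    {S : Finset ℕ} (hS : ∀ k, k ∈ S ↔ ∃ x : C, ν x = k) : C.ncard = S.card := by
  rw [← Set.ncard_image_of_injective C hν, ← Set.ncard_coe_finset]
  congr 1
  ext k
  simp [hS]

end Cut

/-! ### The three Kemeny constants -/

theorem branch_volume_cast {a b e : ℕ} {S : Finset ℕ} (h : S = Finset.Icc e b) (hb : e ≤ b)
    (ha : b - e = a) : 2 * (S.card : ℝ) - 1 = 2 * a + 1 := by
  rw [h, Nat.card_Icc, show b + 1 - e = a + 1 by omega]
  push_cast
  ring

theorem graphKemeny_threeBranchAdj {p q r : ℕ} [Fintype (BranchVertex p q r)]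
    [DecidableEq (BranchVertex p q r)] (hp : 1 ≤ p) {v : ℝ}
    (hv : v = 2 * (p + q + r)) :
    graphKemeny (threeBranchAdj p q r) =
      (p * (p + 0) - (p * (2 * p - 1) * (2 * p + 1) / 3 + 2 * 0 * p ^ 2 + p * 0 ^ 2) / v)
      + (q * (q + 0) - (q * (2 * q - 1) * (2 * q + 1) / 3 + 2 * 0 * q ^ 2 + q * 0 ^ 2) / v)
      + (r * (r + 0) - (r * (2 * r - 1) * (2 * r + 1) / 3 + 2 * 0 * r ^ 2 + r * 0 ^ 2) / v) := by
  set f : ℕ → ℝ := fun e => 2 * ((branchEnd p q r e - e : ℕ) : ℝ) + 1 with hf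
  have hS : (Finset.Icc 1 (p + q + r + 1)).erase 1 = Finset.Ico (1 + 1) (p + q + 1 + r + 1) := by
    ext k
    simp only [Finset.mem_erase, Finset.mem_Icc, Finset.mem_Ico]
    omega
  rw [graphKemeny_eq_sum_branch (threeBranchAdj p q r) p q r Subtype.val Subtype.val_injective
    (Finset.Icc 1 (p + q + r + 1)) (fun k => by simp) 1 (by simp)
    (fun k hk => by rw [Finset.mem_Icc] at hk; simp only [branchEnd]; split_ifs <;> omega)
    (fun k hk hk1 => by
      rw [Finset.mem_Icc] at hk ⊢
      simp only [branchParent]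
      split_ifs <;> omega)
    -- No loop: weight `0` at the label `0`, which is not a vertex.
    0 0 le_rfl (fun x => by rw [threeBranchAdj_apply_self]; simp)
    (fun x y _ => threeBranchAdj_apply x y)
    (Or.inr ⟨2, by rw [Finset.mem_Icc]; omega, by omega, by simp [branchParent]⟩) f v ?_ ?_,
    hS, ← Finset.sum_Ico_consecutive _ (show 1 + 1 ≤ p + q + 1 + 1 by omega) (by omega),
    ← Finset.sum_Ico_consecutive _ (show 1 + 1 ≤ 1 + p + 1 by omega)
      (show 1 + p + 1 ≤ p + q + 1 + 1 by omega),
    sum_Ico_sub_sq_div f 1 p 0 v, show 1 + p + 1 = (p + 1) + 1 by omega,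
    show p + q + 1 + 1 = (p + 1) + q + 1 by omega, sum_Ico_sub_sq_div f (p + 1) q 0 v,
    show (p + 1) + q + 1 = (p + q + 1) + 1 by omega, sum_Ico_sub_sq_div f (p + q + 1) r 0 v]
  · intro k hk
    have : branchEnd p q r (p + q + 1 + 1 + k) - (p + q + 1 + 1 + k) = r - 1 - k := by
      unfold branchEnd
      split_ifs <;> omega
    rw [hf]
    simp only [this]
    rw [Nat.cast_sub (by omega), Nat.cast_sub (by omega)]
    push_cast
    ring
  · intro k hk
    have : branchEnd p q r (p + 1 + 1 + k) - (p + 1 + 1 + k) = q - 1 - k := by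
      unfold branchEnd
      split_ifs <;> omega
    rw [hf]
    simp only [this]
    rw [Nat.cast_sub (by omega), Nat.cast_sub (by omega)]
    push_cast
    ring
  · intro k hk
    have : branchEnd p q r (1 + 1 + k) - (1 + 1 + k) = p - 1 - k := by
      unfold branchEnd
      split_ifs <;> omega
    rw [hf]
    simp only [this]
    rw [Nat.cast_sub (by omega), Nat.cast_sub (by omega)]
    push_cast
    ring
  · intro e he
    simp only [Finset.mem_erase, Finset.mem_Icc] at he
    rw [if_neg (by simp), add_zero, hf]
    refine (branch_volume_cast ?_ (le_branchEnd he.2.2) rfl).symm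
    ext k
    rw [Finset.mem_filter]
    simp only [Finset.mem_Icc, branchEnd]
    split_ifs <;> omega
  · rw [hv, if_neg (by simp), Nat.card_Icc]
    push_cast
    ring

theorem mem_Icc_outer_iff {p q r i : ℕ} {u w : BranchVertex p q r} (hu : u.1 = i)
    (hw : w.1 = i + 1) (hi1 : 1 ≤ i) (hip : i ≤ p) (k : ℕ) :
    k ∈ Finset.Icc (i + 1) (p + 1) ↔
      ∃ x : componentOf (cutAdj (threeBranchAdj p q r) u w) w, x.1.1 = k := by
  simp only [Subtype.exists, mem_componentOf_outer hu hw hi1 hip, Finset.mem_Icc]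
  constructor
  · intro h
    exact ⟨k, by omega, h, rfl⟩
  · rintro ⟨k, hk, h, rfl⟩
    exact h

theorem mem_union_inner_iff {p q r i : ℕ} {u w : BranchVertex p q r} (hu : u.1 = i)
    (hw : w.1 = i + 1) (hi1 : 1 ≤ i) (hip : i ≤ p) (k : ℕ) :
    k ∈ Finset.Icc 1 i ∪ Finset.Icc (p + 2) (p + q + r + 1) ↔
      ∃ x : componentOf (cutAdj (threeBranchAdj p q r) u w) u, x.1.1 = k := by
  simp only [Subtype.exists, mem_componentOf_inner hu hw hi1 hip, Finset.mem_Icc,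
    Finset.mem_union]
  constructor
  · intro h
    exact ⟨k, by omega, by omega, rfl⟩
  · rintro ⟨k, hk, h, rfl⟩
    omega

theorem subtype_val_val_injective {p q r : ℕ} (C : Set (BranchVertex p q r)) :
    Function.Injective fun x : C => x.1.1 :=
  Subtype.val_injective.comp Subtype.val_injective

theorem card_union_inner {p q r i : ℕ} (hip : i ≤ p) :
    (Finset.Icc 1 i ∪ Finset.Icc (p + 2) (p + q + r + 1)).card = i + q + r := by
  rw [Finset.card_union_of_disjoint, Nat.card_Icc, Nat.card_Icc]
  · omega
  · rw [Finset.disjoint_left]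
    simp only [Finset.mem_Icc]
    omega

/-- Rooted at `i + 1`, this path carries its loop at the root, hence below no edge: the loop adds
`1` to the total volume and nothing to the branch volumes. -/
theorem graphKemeny_outer {p q r i n : ℕ} {u w : BranchVertex p q r} (hu : u.1 = i)
    (hw : w.1 = i + 1) (hi1 : 1 ≤ i) (hn : p = i + n)
    [Fintype (componentOf (cutAdj (threeBranchAdj p q r) u w) w)]
    [DecidableEq (componentOf (cutAdj (threeBranchAdj p q r) u w) w)] {v : ℝ}
    (hv : v = 2 * n + 1) :
    graphKemeny (componentAdj (cutAdj (threeBranchAdj p q r) u w) w) =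
      n * (n + 0) - (n * (2 * n - 1) * (2 * n + 1) / 3 + 2 * 0 * n ^ 2 + n * 0 ^ 2) / v := by
  have hip : i ≤ p := by omega
  set f : ℕ → ℝ := fun e => 2 * ((p + 1 - e : ℕ) : ℝ) + 1 with hf
  have hS : (Finset.Icc (i + 1) (p + 1)).erase (i + 1)
      = Finset.Ico (i + 1 + 1) (i + 1 + n + 1) := by
    ext k
    simp only [Finset.mem_erase, Finset.mem_Icc, Finset.mem_Ico]
    omega
  rw [graphKemeny_eq_sum_branch _ p q r (fun x => x.1.1) (subtype_val_val_injective _)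
    (Finset.Icc (i + 1) (p + 1)) (mem_Icc_outer_iff hu hw hi1 hip) (i + 1)
    (by rw [Finset.mem_Icc]; omega)
    (fun k hk => by rw [Finset.mem_Icc] at hk; simp only [branchEnd]; split_ifs <;> omega)
    (fun k hk hk1 => by
      rw [Finset.mem_Icc] at hk ⊢
      simp only [branchParent]
      split_ifs <;> omega)
    (i + 1) 1 zero_le_one ?_ ?_ (Or.inl ⟨rfl, one_pos⟩) f v ?_ ?_, hS,
    sum_Ico_sub_sq_div f (i + 1) n 0 v]
  · intro k hk
    have : p + 1 - (i + 1 + 1 + k) = n - 1 - k := by omega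
    rw [hf]
    simp only [this]
    rw [Nat.cast_sub (by omega), Nat.cast_sub (by omega)]
    push_cast
    ring
  · intro x
    have hx := (mem_componentOf_outer hu hw hi1 hip x.1).1 x.2
    simp only [componentAdj, Matrix.submatrix_apply]
    rw [cutAdj_threeBranchAdj_apply_self hu hw hi1 hip]
    exact if_congr (by omega) rfl rfl
  · intro x y hxy
    have hx := (mem_componentOf_outer hu hw hi1 hip x.1).1 x.2
    have hy := (mem_componentOf_outer hu hw hi1 hip y.1).1 y.2
    simp only [componentAdj, Matrix.submatrix_apply]
    rw [cutAdj_apply_of_ne (Subtype.coe_ne_coe.2 hxy)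
      (by simp only [Subtype.ext_iff, hu, hw]; omega), threeBranchAdj_apply]
    congr 1 <;>
    · refine if_congr ?_ rfl rfl
      simp only [branchParent]
      split_ifs <;> omega
  · intro e he
    simp only [Finset.mem_erase, Finset.mem_Icc] at he
    rw [if_neg (by omega), add_zero, hf]
    refine (branch_volume_cast (b := p + 1) ?_ (by omega) rfl).symm
    ext k
    rw [Finset.mem_filter]
    simp only [Finset.mem_Icc, branchEnd]
    split_ifs <;> omega
  · rw [hv, if_pos (by rw [Finset.mem_Icc]; omega), Nat.card_Icc,
      show p + 1 + 1 - (i + 1) = n + 1 by omega]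
    push_cast
    ring

/-- The loop at `i` lies below all `n = i - 1` edges of the truncated branch and below none on the
other two, whence the loop weights `1, 0, 0`. -/
theorem graphKemeny_inner {p q r i n : ℕ} {u w : BranchVertex p q r} (hu : u.1 = i)
    (hw : w.1 = i + 1) (hn : i = n + 1) (hip : i ≤ p)
    [Fintype (componentOf (cutAdj (threeBranchAdj p q r) u w) u)]
    [DecidableEq (componentOf (cutAdj (threeBranchAdj p q r) u w) u)] {v : ℝ}
    (hv : v = 2 * (n + q + r) + 1) :
    graphKemeny (componentAdj (cutAdj (threeBranchAdj p q r) u w) u) =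
      (n * (n + 1) - (n * (2 * n - 1) * (2 * n + 1) / 3 + 2 * 1 * n ^ 2 + n * 1 ^ 2) / v)
      + (q * (q + 0) - (q * (2 * q - 1) * (2 * q + 1) / 3 + 2 * 0 * q ^ 2 + q * 0 ^ 2) / v)
      + (r * (r + 0) - (r * (2 * r - 1) * (2 * r + 1) / 3 + 2 * 0 * r ^ 2 + r * 0 ^ 2) / v) := by
  have hi1 : 1 ≤ i := by omega
  set S := Finset.Icc 1 i ∪ Finset.Icc (p + 2) (p + q + r + 1) with hS_def
  have hmem : ∀ k, k ∈ S ↔ (1 ≤ k ∧ k ≤ i) ∨ (p + 2 ≤ k ∧ k ≤ p + q + r + 1) := fun k => by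
    rw [hS_def, Finset.mem_union, Finset.mem_Icc, Finset.mem_Icc]
  -- The additional `+ 1` for `e ≤ i` is the loop at `i`, where the first branch now ends.
  set f : ℕ → ℝ := fun e => if e ≤ i then 2 * ((i - e : ℕ) : ℝ) + 1 + 1
    else 2 * ((branchEnd p q r e - e : ℕ) : ℝ) + 1 with hf
  have hS : S.erase 1 = Finset.Ico (1 + 1) (1 + n + 1)
      ∪ Finset.Ico (p + 1 + 1) (p + q + 1 + r + 1) := by
    ext k
    simp only [Finset.mem_erase, hmem, Finset.mem_Ico, Finset.mem_union]
    omega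
  have hdisj : Disjoint (Finset.Ico (1 + 1) (1 + n + 1))
      (Finset.Ico (p + 1 + 1) (p + q + 1 + r + 1)) := by
    rw [Finset.disjoint_left]
    simp only [Finset.mem_Ico]
    omega
  rw [graphKemeny_eq_sum_branch _ p q r (fun x => x.1.1) (subtype_val_val_injective _)
    S (mem_union_inner_iff hu hw hi1 hip) 1 (by rw [hmem]; omega)
    (fun k hk => by rw [hmem] at hk; simp only [branchEnd]; split_ifs <;> omega)
    (fun k hk hk1 => by
      rw [hmem] at hk ⊢
      simp only [branchParent]
      split_ifs <;> omega)
    i 1 zero_le_one ?_ ?_ ?_ f v ?_ ?_, hS, Finset.sum_union hdisj,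
    ← Finset.sum_Ico_consecutive _ (show p + 1 + 1 ≤ p + q + 1 + 1 by omega) (by omega),
    sum_Ico_sub_sq_div f 1 n 1 v,
    show p + q + 1 + 1 = (p + 1) + q + 1 by omega, sum_Ico_sub_sq_div f (p + 1) q 0 v,
    show (p + 1) + q + 1 = (p + q + 1) + 1 by omega, sum_Ico_sub_sq_div f (p + q + 1) r 0 v,
    ← add_assoc]
  · intro k hk
    have : branchEnd p q r (p + q + 1 + 1 + k) - (p + q + 1 + 1 + k) = r - 1 - k := by
      unfold branchEnd
      split_ifs <;> omega
    rw [hf]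
    simp only [this]
    rw [if_neg (by omega), Nat.cast_sub (by omega), Nat.cast_sub (by omega)]
    push_cast
    ring
  · intro k hk
    have : branchEnd p q r (p + 1 + 1 + k) - (p + 1 + 1 + k) = q - 1 - k := by
      unfold branchEnd
      split_ifs <;> omega
    rw [hf]
    simp only [this]
    rw [if_neg (by omega), Nat.cast_sub (by omega), Nat.cast_sub (by omega)]
    push_cast
    ring
  · intro k hk
    have : i - (1 + 1 + k) = n - 1 - k := by omega
    rw [hf]
    simp only [this]
    rw [if_pos (by omega), Nat.cast_sub (by omega), Nat.cast_sub (by omega)]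
    push_cast
    ring
  · intro x
    have hx := (mem_componentOf_inner hu hw hi1 hip x.1).1 x.2
    simp only [componentAdj, Matrix.submatrix_apply]
    rw [cutAdj_threeBranchAdj_apply_self hu hw hi1 hip]
    exact if_congr (by omega) rfl rfl
  · intro x y hxy
    have hx := (mem_componentOf_inner hu hw hi1 hip x.1).1 x.2
    have hy := (mem_componentOf_inner hu hw hi1 hip y.1).1 y.2
    simp only [componentAdj, Matrix.submatrix_apply]
    rw [cutAdj_apply_of_ne (Subtype.coe_ne_coe.2 hxy)
      (by simp only [Subtype.ext_iff, hu, hw]; omega), threeBranchAdj_apply]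
  -- For `i = 1` the loop is at the root and makes its degree positive, even if the component is a
  -- single vertex.
  · by_cases h : i = 1
    · exact Or.inl ⟨h.symm, one_pos⟩
    · exact Or.inr ⟨2, by rw [hmem]; omega, by omega, by simp [branchParent]⟩
  · intro e he
    rw [Finset.mem_erase, hmem] at he
    by_cases hei : e ≤ i
    · simp only [hf, if_pos hei]
      rw [if_pos (by rw [hmem]; simp only [branchEnd]; split_ifs <;> omega)]
      congr 1
      refine (branch_volume_cast (b := i) ?_ hei rfl).symm
      ext k
      rw [Finset.mem_filter, hmem]
      simp only [Finset.mem_Icc, branchEnd]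
      split_ifs <;> omega
    · simp only [hf, if_neg hei]
      rw [if_neg fun h => hei h.2.1, add_zero]
      refine (branch_volume_cast ?_ (le_branchEnd (by omega)) rfl).symm
      ext k
      rw [Finset.mem_filter, hmem]
      simp only [Finset.mem_Icc, branchEnd]
      split_ifs <;> omega
  · rw [hv, if_pos (by rw [hmem]; omega), card_union_inner hip, hn]
    push_cast
    ring

/-! ### The centrality of the edge -/

/-- Frees the cut-edge case of the definition from its classical instances. -/
theorem edgeCentrality_of_isBridge {V : Type*} [Fintype V] [inst : DecidableEq V]
    (A : Matrix V V ℝ) (i j : V) (h : (supportGraph A).IsBridge s(i, j))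
    [Fintype (componentOf (cutAdj A i j) i)] [DecidableEq (componentOf (cutAdj A i j) i)]
    [Fintype (componentOf (cutAdj A i j) j)] [DecidableEq (componentOf (cutAdj A i j) j)] :
    edgeCentrality A i j = graphKemeny A - graphKemeny (componentAdj (cutAdj A i j) i)
      - graphKemeny (componentAdj (cutAdj A i j) j) := by
  have hinst : inst = fun a b => Classical.propDecidable (a = b) := Subsingleton.elim _ _
  subst hinst
  rw [edgeCentrality, if_pos h]
  congr!
/-- For the tree `E_{p,q,r}` and `1 ≤ i ≤ p`, the pair `(i, i+1)` is a cut-edge; with the edge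
replaced by loops at its endpoints, the component of `i + 1` has `α = p + 1 - i` vertices and that of
`i` has `β = q + r + i`; and the centrality of the edge is
`(2/3) α β + 2qr (2i-1)/(2i-1+2q+2r) - γ` with `γ = s/3 - 1/6 + 2pqr/s`, `s = p + q + r`. -/
theorem mainTheorem1 (p q r i : ℕ) (hi1 : 1 ≤ i) (hip : i ≤ p) :
    let A := threeBranchAdj p q r
    let u := branchVertex p q r i hi1 (by omega)
    let w := branchVertex p q r (i + 1) (by omega) (by omega)
    let s : ℝ := (p : ℝ) + q + r
    let α : ℝ := (p : ℝ) + 1 - i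
    let β : ℝ := (q : ℝ) + r + i
    let γ : ℝ := s / 3 - 1 / 6 + 2 * p * q * r / s
    (threeBranchTree p q r).Adj u w ∧
      (threeBranchTree p q r).IsBridge s(u, w) ∧
      ((componentOf (cutAdj A u w) w).ncard : ℝ) = α ∧
      ((componentOf (cutAdj A u w) u).ncard : ℝ) = β ∧
      edgeCentrality A u w =
        2 / 3 * α * β + 2 * q * r * (2 * i - 1) / (2 * i - 1 + 2 * q + 2 * r) - γ := by
  intro A u w s α β γ
  have hu : u.1 = i := rfl
  have hw : w.1 = i + 1 := rfl
  refine ⟨threeBranchTree_adj_edge hu hw hi1 hip, threeBranchTree_isBridge hu hw hi1 hip,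
    ?_, ?_, ?_⟩
  · rw [ncard_componentOf Subtype.val_injective (mem_Icc_outer_iff hu hw hi1 hip), Nat.card_Icc,
      Nat.cast_sub (by omega)]
    push_cast
    ring
  · rw [ncard_componentOf Subtype.val_injective (mem_union_inner_iff hu hw hi1 hip),
      card_union_inner hip]
    push_cast
    ring
  · classical
    -- The numbers of edges of the first branch on the two sides of the cut; with them no truncated
    -- subtraction is left.
    obtain ⟨n, hn⟩ : ∃ n, i = n + 1 := ⟨i - 1, by omega⟩
    obtain ⟨m, hm⟩ : ∃ m, p = i + m := ⟨p - i, by omega⟩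
    have hb : (supportGraph A).IsBridge s(u, w) := by
      rw [supportGraph_threeBranchAdj]
      exact threeBranchTree_isBridge hu hw hi1 hip
    have hiR : (i : ℝ) = n + 1 := by rw [hn]; push_cast; ring
    have hpR : (p : ℝ) = n + 1 + m := by rw [hm, Nat.cast_add, hiR]
    rw [edgeCentrality_of_isBridge A u w hb, graphKemeny_threeBranchAdj (hi1.trans hip) rfl,
      graphKemeny_inner hu hw hn hip rfl, graphKemeny_outer hu hw hi1 hm rfl]
    simp only [γ, α, β, s, hpR, hiR]
    -- The denominators: half the volume of the tree, and the volumes of the inner and the outer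
    -- component.
    have h1 : (n : ℝ) + 1 + m + q + r ≠ 0 := by positivity
    have h2 : 2 * ((n : ℝ) + q + r) + 1 ≠ 0 := by positivity
    have h3 : 2 * (m : ℝ) + 1 ≠ 0 := by positivity
    have h4 : 2 * ((n : ℝ) + 1) - 1 + 2 * q + 2 * r = 2 * (n + q + r) + 1 := by ring
    rw [h4]
    field_simp
    ring
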